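/- There is an absolute constant $C>0$ such that the following holds. Let $A\in\mathbb{R}^{n\times d}$ be any real matrix with rows $a_1,\dots,a_n\in\mathbb{R}^d$, let $\varepsilon\in(0,1]$, and let $k\ge 1$ be an integer. Then there is a weight vector $w=(w_1,\dots,w_n)\in[0,\infty)^n$ with at most $C\,k/\varepsilon^2$ nonzero entries such that for every $k$-dimensional linear subspace $S$ of $\mathbb{R}^d$, $$\Bigl|\sum_{i=1}^n \mathrm{dist}(a_i,S)^2-\sum_{i=1}^n \mathrm{dist}(w_i a_i,S)^2\Bigr|\le \varepsilon\sum_{i=1}^n \mathrm{dist}(a_i,S)^2,$$ where $\mathrm{dist}(x,S)=\inf_{s\in S}\|x-s\|_2$ is the Euclidean distance; here $\mathrm{dist}(w_i a_i,S)^2=w_i^2\,\mathrm{dist}(a_i,S)^2$. In other words, $A$ has an $(\varepsilon,k)$-coreset that is a weighted subset of its rows and whose size is $O(k/\varepsilon^2)$, independently of $n$ and $d$. -/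

import Mathlib

/-- The `i`-th row of a real `n × d` matrix, as a point of Euclidean space `ℝ^d`. -/
def rowPoint {n d : ℕ} (A : Matrix (Fin n) (Fin d) ℝ) (i : Fin n) :
    EuclideanSpace ℝ (Fin d) :=
  WithLp.toLp 2 (A i)

/-- The sum of the squared Euclidean distances of finitely many points to a linear subspace. -/
noncomputable def sumSqDist {n d : ℕ} (p : Fin n → EuclideanSpace ℝ (Fin d))
    (S : Submodule ℝ (EuclideanSpace ℝ (Fin d))) : ℝ :=
  ∑ i, (Metric.infDist (p i) (S : Set (EuclideanSpace ℝ (Fin d)))) ^ 2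

/-- The number of nonzero entries of a weight vector. -/
noncomputable def sparsity {n : ℕ} (w : Fin n → ℝ) : ℕ :=
  Set.ncard {i | w i ≠ 0}

/-- The weight vector `w` defines an `(ε, k)`-coreset for the rows of `A`: the weights are
non-negative and, for every `k`-dimensional linear subspace `S` of `ℝ^d`, the sum of squared
distances from the weighted rows `w i • a i` to `S` agrees with the sum of squared distances
from the rows `a i` to `S`, up to a relative error of `ε`. -/
structure IsCoreset {n d : ℕ} (A : Matrix (Fin n) (Fin d) ℝ) (ε : ℝ) (k : ℕ)
    (w : Fin n → ℝ) : Prop where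
  nonneg : ∀ i, 0 ≤ w i
  approx : ∀ S : Submodule ℝ (EuclideanSpace ℝ (Fin d)), Module.finrank ℝ S = k →
    |sumSqDist (fun i => rowPoint A i) S - sumSqDist (fun i => w i • rowPoint A i) S| ≤
      ε * sumSqDist (fun i => rowPoint A i) S

/-!
Write `G = ∑ aᵢ aᵢᵀ` for the Gram matrix of the rows, `sᵢ = wᵢ²`, and `D = ∑ (sᵢ - 1) aᵢ aᵢᵀ`. The
sum of squared distances to `S` is the trace of `G` against the orthogonal projection to `Sᗮ`, so
the weights have to make the trace of `D` against that projection small for every `S`.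

**Reduction to one subspace and a ridge bound.** Let `Q` be a `k`-dimensional subspace of minimal
residual `OPT`, and let `c = OPT / k`. With `R = Q ⊔ S`, the projection to `Sᗮ` is the projection
to `Qᗮ`, minus the projection to `Qᗮ ⊓ R`, plus the projection to `Sᗮ ⊓ R`, and the last two
subspaces have dimension at most `k`. It therefore suffices that the weights preserve the residual
of the single subspace `Q` up to `2 ε OPT`, and that `|xᵀ D x| ≤ ε (2 xᵀ G x + c |x|²)` for all `x`:
summed over an orthonormal basis of a `k`-dimensional subspace, the ridge term contributes only
`ε k c = ε OPT`, which is at most `ε` times the residual of `S`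
(`abs_sum_sub_one_mul_orthogonal_le`). If `OPT = 0`, a ridge smaller than the quadratic form of `G`
on the span of the rows does the same work (`exists_coreset_of_forall_mem`).

**Sparsification.** Such weights come from a dimension-free version of the barrier method of Batson,
Spielman and Srivastava (`exists_sparse_weights`). For a positive definite `H` the barriers are
`± ε T H + t (1 ± ε) G` after `t` of `T` steps, and the potentials are the traces of `G` against the
inverses of the gaps to the barriers. The initial potentials are the effective dimension, the trace
of `G H⁻¹`, divided by `ε T`; hence the number of steps depends on the effective dimension and not
on the ambient one. For `H = G + c` the effective dimension is at most `2 k`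
(`quadSum_ridge_inv_le`). The constraint for `Q` enters by appending to each row its distance to `Q`
as a further coordinate, which raises the effective dimension by at most `1`
(`exists_sparse_weights_and_sum_sq`).
-/

/-! ### Rank-one updates of positive definite matrices -/

section RankOne

open Matrix

/-- The Cauchy–Schwarz inequality between the quadratic forms of a positive definite matrix and
of its inverse. -/
theorem Matrix.PosDef.dotProduct_sq_le {ι : Type*} [Fintype ι] [DecidableEq ι]
    {B : Matrix ι ι ℝ} (hB : B.PosDef) (v x : ι → ℝ) :
    (v ⬝ᵥ x) ^ 2 ≤ (v ⬝ᵥ B⁻¹ *ᵥ v) * (x ⬝ᵥ B *ᵥ x) := by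
  have hBs : Bᵀ = B := by simpa using hB.isHermitian.eq
  have hu : IsUnit B.det := (Matrix.isUnit_iff_isUnit_det B).1 hB.isUnit
  set y := B⁻¹ *ᵥ v with hy
  have hBy : B *ᵥ y = v := by rw [hy, mulVec_mulVec, Matrix.mul_nonsing_inv _ hu, one_mulVec]
  have h1 : x ⬝ᵥ B *ᵥ y = v ⬝ᵥ x := by rw [hBy, dotProduct_comm]
  have h2 : y ⬝ᵥ B *ᵥ x = v ⬝ᵥ x := by
    rw [dotProduct_mulVec, ← mulVec_transpose, hBs, hBy]
  have h3 : y ⬝ᵥ B *ᵥ y = v ⬝ᵥ y := by rw [hBy, dotProduct_comm]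
  have key : ∀ t : ℝ, 0 ≤ (v ⬝ᵥ y) * (t * t) + (-2 * (v ⬝ᵥ x)) * t + (x ⬝ᵥ B *ᵥ x) := by
    intro t
    have := hB.posSemidef.dotProduct_mulVec_nonneg (x - t • y)
    simp only [star_trivial, mulVec_sub, mulVec_smul, sub_dotProduct, dotProduct_sub,
      smul_dotProduct, dotProduct_smul, h1, h2, h3, smul_eq_mul] at this
    linarith
  have := discrim_le_zero key
  unfold discrim at this
  linarith

/-- The Sherman–Morrison formula for a symmetric rank-one update. -/
theorem Matrix.inv_add_smul_vecMulVec {ι : Type*} [Fintype ι] [DecidableEq ι]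
    {B : Matrix ι ι ℝ} (hB : B.PosDef) (v : ι → ℝ) {s : ℝ}
    (hs : 1 + s * (v ⬝ᵥ B⁻¹ *ᵥ v) ≠ 0) :
    (B + s • vecMulVec v v)⁻¹ =
      B⁻¹ - (s / (1 + s * (v ⬝ᵥ B⁻¹ *ᵥ v))) • vecMulVec (B⁻¹ *ᵥ v) (B⁻¹ *ᵥ v) := by
  have hu : IsUnit B.det := (Matrix.isUnit_iff_isUnit_det B).1 hB.isUnit
  have hXs : (B⁻¹)ᵀ = B⁻¹ := by simpa using hB.inv.isHermitian.eq
  apply inv_eq_right_inv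
  have hvX : v ᵥ* B⁻¹ = B⁻¹ *ᵥ v := by rw [← mulVec_transpose, hXs]
  have e1 : B * vecMulVec (B⁻¹ *ᵥ v) (B⁻¹ *ᵥ v) = vecMulVec v (B⁻¹ *ᵥ v) := by
    rw [mul_vecMulVec, mulVec_mulVec, Matrix.mul_nonsing_inv _ hu, one_mulVec]
  have e2 : vecMulVec v v * B⁻¹ = vecMulVec v (B⁻¹ *ᵥ v) := by
    rw [vecMulVec_mul, hvX]
  have e3 : vecMulVec v v * vecMulVec (B⁻¹ *ᵥ v) (B⁻¹ *ᵥ v) =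
      (v ⬝ᵥ B⁻¹ *ᵥ v) • vecMulVec v (B⁻¹ *ᵥ v) := by
    rw [vecMulVec_mul_vecMulVec, vecMulVec_smul]
  rw [Matrix.add_mul, Matrix.mul_sub, Matrix.mul_sub, Matrix.mul_nonsing_inv _ hu, Matrix.mul_smul,
    Matrix.mul_smul, Matrix.smul_mul, Matrix.smul_mul, e1, e2, e3]
  set W := vecMulVec v (B⁻¹ *ᵥ v)
  set p := v ⬝ᵥ B⁻¹ *ᵥ v
  have : s - s / (1 + s * p) - s / (1 + s * p) * s * p = 0 := by field_simp; ring
  have h2 : (1 : Matrix ι ι ℝ) - (s / (1 + s * p)) • W + (s • W - (s / (1 + s * p)) • s • p • W) =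
      1 + (s - s / (1 + s * p) - s / (1 + s * p) * s * p) • W := by
    module
  rw [h2, this, zero_smul, add_zero]

end RankOne

/-! ### Weighted Gram matrices and their potentials -/

open Matrix in
/-- The weighted Gram matrix `∑ i, s i • v i (v i)ᵀ` of a finite family of vectors. -/
noncomputable def weightedGram {κ ι : Type*} [Fintype κ] (v : κ → ι → ℝ) (s : κ → ℝ) :
    Matrix ι ι ℝ :=
  ∑ i, s i • vecMulVec (v i) (v i)

open Matrix in
/-- The sum of the values at the vectors `v i` of the quadratic form of `N`, i.e. the trace of
the product of `N` with the Gram matrix `∑ i, v i (v i)ᵀ`. -/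
noncomputable def quadSum {κ ι : Type*} [Fintype κ] [Fintype ι] (v : κ → ι → ℝ)
    (N : Matrix ι ι ℝ) : ℝ :=
  ∑ i, v i ⬝ᵥ N *ᵥ v i

section GramForms

open Matrix

variable {κ ι : Type*} [Fintype κ]

theorem weightedGram_transpose (v : κ → ι → ℝ) (s : κ → ℝ) :
    (weightedGram v s)ᵀ = weightedGram v s := by
  simp [weightedGram, transpose_sum, transpose_vecMulVec]

theorem weightedGram_add (v : κ → ι → ℝ) (s t : κ → ℝ) :
    weightedGram v (s + t) = weightedGram v s + weightedGram v t := by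
  simp [weightedGram, add_smul, Finset.sum_add_distrib]

theorem weightedGram_single [DecidableEq κ] (v : κ → ι → ℝ) (i : κ) (c : ℝ) :
    weightedGram v (Pi.single i c) = c • vecMulVec (v i) (v i) := by
  rw [weightedGram, Finset.sum_eq_single i] <;> simp +contextual

variable [Fintype ι]

theorem dotProduct_vecMulVec_mulVec (v x y : ι → ℝ) :
    x ⬝ᵥ vecMulVec v v *ᵥ y = (v ⬝ᵥ x) * (v ⬝ᵥ y) := by
  rw [vecMulVec_mulVec]
  simp [dotProduct_smul, dotProduct_comm x v, mul_comm]

theorem dotProduct_weightedGram_mulVec (v : κ → ι → ℝ) (s : κ → ℝ) (x y : ι → ℝ) :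
    x ⬝ᵥ weightedGram v s *ᵥ y = ∑ i, s i * ((v i ⬝ᵥ x) * (v i ⬝ᵥ y)) := by
  simp only [weightedGram, sum_mulVec, dotProduct_sum, smul_mulVec, dotProduct_smul,
    dotProduct_vecMulVec_mulVec, smul_eq_mul]

theorem posSemidef_weightedGram (v : κ → ι → ℝ) {s : κ → ℝ} (hs : ∀ i, 0 ≤ s i) :
    (weightedGram v s).PosSemidef := by
  refine PosSemidef.of_dotProduct_mulVec_nonneg ?_ fun x => ?_
  · simpa [IsHermitian] using weightedGram_transpose v s
  · rw [star_trivial, dotProduct_weightedGram_mulVec]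
    exact Finset.sum_nonneg fun i _ => mul_nonneg (hs i) (mul_self_nonneg _)

theorem quadSum_add (v : κ → ι → ℝ) (N N' : Matrix ι ι ℝ) :
    quadSum v (N + N') = quadSum v N + quadSum v N' := by
  simp [quadSum, add_mulVec, Finset.sum_add_distrib]

theorem quadSum_sub (v : κ → ι → ℝ) (N N' : Matrix ι ι ℝ) :
    quadSum v (N - N') = quadSum v N - quadSum v N' := by
  simp [quadSum, sub_mulVec, Finset.sum_sub_distrib]

theorem quadSum_smul (v : κ → ι → ℝ) (c : ℝ) (N : Matrix ι ι ℝ) :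
    quadSum v (c • N) = c * quadSum v N := by
  simp [quadSum, smul_mulVec, Finset.mul_sum]

theorem quadSum_nonneg (v : κ → ι → ℝ) {N : Matrix ι ι ℝ} (hN : N.PosSemidef) :
    0 ≤ quadSum v N :=
  Finset.sum_nonneg fun i _ => by simpa using hN.dotProduct_mulVec_nonneg (v i)

theorem quadSum_vecMulVec (v : κ → ι → ℝ) (x : ι → ℝ) :
    quadSum v (vecMulVec x x) = x ⬝ᵥ weightedGram v 1 *ᵥ x := by
  rw [dotProduct_weightedGram_mulVec]
  simp [quadSum, dotProduct_vecMulVec_mulVec, dotProduct_comm x]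

variable [DecidableEq ι]

/-- Two-sided estimates for the decrease of the potential `quadSum v B⁻¹` when the barrier `B`
grows by a multiple of the Gram matrix: it lies between the first-order terms at both ends. -/
theorem quadSum_inv_sub_bounds (v : κ → ι → ℝ) {B : Matrix ι ι ℝ} (hB : B.PosDef) {η : ℝ}
    (hC : (B + η • weightedGram v 1).PosDef) :
    η * quadSum v ((B + η • weightedGram v 1)⁻¹ * weightedGram v 1 *
        (B + η • weightedGram v 1)⁻¹) ≤
      quadSum v B⁻¹ - quadSum v (B + η • weightedGram v 1)⁻¹ ∧
    quadSum v B⁻¹ - quadSum v (B + η • weightedGram v 1)⁻¹ ≤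
      η * quadSum v (B⁻¹ * weightedGram v 1 * B⁻¹) := by
  set M := weightedGram v 1 with hM
  set X := (B + η • M)⁻¹ with hX
  set Z := B⁻¹ with hZ
  have uB : IsUnit B.det := (Matrix.isUnit_iff_isUnit_det B).1 hB.isUnit
  have uC : IsUnit (B + η • M).det := (Matrix.isUnit_iff_isUnit_det _).1 hC.isUnit
  have hMs : Mᵀ = M := weightedGram_transpose v 1
  have hXs : Xᵀ = X := by simpa using hC.inv.isHermitian.eq
  have hZs : Zᵀ = Z := by simpa using hB.inv.isHermitian.eq
  have i1 : Z - X = η • (Z * M * X) := by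
    have : Z * ((B + η • M) - B) * X = Z - X := by
      rw [Matrix.mul_sub, Matrix.sub_mul, Matrix.mul_assoc, Matrix.mul_nonsing_inv _ uC,
        Matrix.nonsing_inv_mul _ uB, Matrix.mul_one, Matrix.one_mul]
    rw [← this]; simp [Matrix.mul_assoc]
  have i2 : Z - X = η • (X * M * Z) := by
    have := congrArg transpose i1
    simpa [transpose_mul, hMs, hXs, hZs, Matrix.mul_assoc] using this
  have e1 : Z - X = η • (X * M * X) + (η ^ 2) • (X * M * Z * M * X) := by
    have hz : Z = X + η • (X * M * Z) := by rw [← i2]; abel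
    calc Z - X = η • (Z * M * X) := i1
      _ = η • ((X + η • (X * M * Z)) * M * X) := by rw [← hz]
      _ = _ := by
        rw [Matrix.add_mul, Matrix.add_mul, Matrix.smul_mul, Matrix.smul_mul, smul_add, smul_smul,
          pow_two]
  have e2 : Z - X = η • (Z * M * Z) - (η ^ 2) • (Z * M * X * M * Z) := by
    have hx : X = Z - η • (Z * M * X) := by rw [← i1]; abel
    calc Z - X = η • (X * M * Z) := i2
      _ = η • ((Z - η • (Z * M * X)) * M * Z) := by rw [← hx]
      _ = _ := by
        rw [Matrix.sub_mul, Matrix.sub_mul, Matrix.smul_mul, Matrix.smul_mul, smul_sub, smul_smul,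
          pow_two]
  have p1 : (X * M * Z * M * X).PosSemidef := by
    have := hB.inv.posSemidef.conjTranspose_mul_mul_same (M * X)
    simpa [conjTranspose_eq_transpose_of_trivial, transpose_mul, hMs, hXs, Matrix.mul_assoc]
      using this
  have p2 : (Z * M * X * M * Z).PosSemidef := by
    have := hC.inv.posSemidef.conjTranspose_mul_mul_same (M * Z)
    simpa [conjTranspose_eq_transpose_of_trivial, transpose_mul, hMs, hZs, Matrix.mul_assoc]
      using this
  rw [← quadSum_sub]
  constructor
  · rw [e1, quadSum_add, quadSum_smul, quadSum_smul]
    have := quadSum_nonneg v p1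
    nlinarith [sq_nonneg η]
  · rw [e2, quadSum_sub, quadSum_smul, quadSum_smul]
    have := quadSum_nonneg v p2
    nlinarith [sq_nonneg η]

end GramForms

/-! ### The barrier step -/

section BarrierStep

open Matrix

variable {κ ι : Type*} [Fintype κ] [Fintype ι]

/-- Strict positivity ensures that both potentials change when the barriers move, so that the
admissibility bounds on the step size may be divided by these changes. -/
theorem quadSum_mul_weightedGram_mul_pos (v : κ → ι → ℝ) {N : Matrix ι ι ℝ} (hN : N.PosDef)
    {j : κ} (hj : v j ≠ 0) : 0 < quadSum v (N * weightedGram v 1 * N) := by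
  have hNs : Nᵀ = N := by simpa using hN.isHermitian.eq
  have e : ∀ i, v i ⬝ᵥ (N * weightedGram v 1 * N) *ᵥ v i =
      ∑ l, (v l ⬝ᵥ N *ᵥ v i) * (v l ⬝ᵥ N *ᵥ v i) := by
    intro i
    rw [← mulVec_mulVec, ← mulVec_mulVec, dotProduct_mulVec (v i), ← mulVec_transpose, hNs,
      dotProduct_weightedGram_mulVec]
    simp
  simp only [quadSum, e]
  have hpos : 0 < v j ⬝ᵥ N *ᵥ v j := by simpa using hN.dotProduct_mulVec_pos hj
  refine Finset.sum_pos' (fun i _ => Finset.sum_nonneg fun l _ => mul_self_nonneg _)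
    ⟨j, Finset.mem_univ _, ?_⟩
  exact Finset.sum_pos' (fun l _ => mul_self_nonneg _) ⟨j, Finset.mem_univ _, mul_pos hpos hpos⟩

variable [DecidableEq ι]

theorem Matrix.PosDef.add_smul_vecMulVec {B : Matrix ι ι ℝ} (hB : B.PosDef) (v : ι → ℝ) {s : ℝ}
    (hs : 0 < 1 + s * (v ⬝ᵥ B⁻¹ *ᵥ v)) : (B + s • vecMulVec v v).PosDef := by
  refine PosDef.of_dotProduct_mulVec_pos (hB.isHermitian.add ?_) fun x hx => ?_
  · simp [IsHermitian, conjTranspose_eq_transpose_of_trivial, transpose_vecMulVec]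
  · have hpos : 0 < x ⬝ᵥ B *ᵥ x := by simpa using hB.dotProduct_mulVec_pos hx
    have hcs := hB.dotProduct_sq_le v x
    rw [star_trivial, add_mulVec, dotProduct_add, smul_mulVec, dotProduct_smul,
      dotProduct_vecMulVec_mulVec, smul_eq_mul]
    rcases le_or_gt 0 s with h | h
    · nlinarith [mul_nonneg h (mul_self_nonneg (v ⬝ᵥ x))]
    · nlinarith [mul_pos hs hpos]

theorem quadSum_inv_add_smul_vecMulVec (w : κ → ι → ℝ) {B : Matrix ι ι ℝ} (hB : B.PosDef)
    (v : ι → ℝ) {s : ℝ} (hs : 0 < 1 + s * (v ⬝ᵥ B⁻¹ *ᵥ v)) :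
    quadSum w (B + s • vecMulVec v v)⁻¹ = quadSum w B⁻¹ -
      s / (1 + s * (v ⬝ᵥ B⁻¹ *ᵥ v)) * (v ⬝ᵥ (B⁻¹ * weightedGram w 1 * B⁻¹) *ᵥ v) := by
  have hXs : (B⁻¹)ᵀ = B⁻¹ := by simpa using hB.inv.isHermitian.eq
  rw [inv_add_smul_vecMulVec hB v hs.ne', quadSum_sub, quadSum_smul, quadSum_vecMulVec]
  congr 2
  rw [← mulVec_mulVec, ← mulVec_mulVec, dotProduct_mulVec v, ← mulVec_transpose, hXs]

/-- A positive definite barrier whose potential is at most `φ` dominates `φ⁻¹` times the Gram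
matrix, so it survives the subtraction of `η` times that matrix when `η φ < 1`. -/
theorem posDef_sub_smul_weightedGram (v : κ → ι → ℝ) {L : Matrix ι ι ℝ} (hL : L.PosDef)
    {η φ : ℝ} (hη : 0 ≤ η) (hφ : quadSum v L⁻¹ ≤ φ) (hηφ : η * φ < 1) :
    (L - η • weightedGram v 1).PosDef ∧
      (1 - η * φ) * quadSum v (L - η • weightedGram v 1)⁻¹ ≤ quadSum v L⁻¹ := by
  set M := weightedGram v 1 with hM
  have hMs : Mᵀ = M := weightedGram_transpose v 1
  have hle : ∀ x, (1 - η * φ) * (x ⬝ᵥ L *ᵥ x) ≤ x ⬝ᵥ (L - η • M) *ᵥ x := by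
    intro x
    have h0 : 0 ≤ x ⬝ᵥ L *ᵥ x := by simpa using hL.posSemidef.dotProduct_mulVec_nonneg x
    have h1 : x ⬝ᵥ M *ᵥ x ≤ φ * (x ⬝ᵥ L *ᵥ x) := by
      refine le_trans ?_ (mul_le_mul_of_nonneg_right hφ h0)
      rw [hM, dotProduct_weightedGram_mulVec, quadSum, Finset.sum_mul]
      refine Finset.sum_le_sum fun i _ => ?_
      have := hL.dotProduct_sq_le (v i) x
      simpa [pow_two] using this
    rw [sub_mulVec, dotProduct_sub, smul_mulVec, dotProduct_smul, smul_eq_mul]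
    nlinarith [mul_le_mul_of_nonneg_left h1 hη]
  have hpd : (L - η • M).PosDef := by
    refine PosDef.of_dotProduct_mulVec_pos (hL.isHermitian.sub ?_) fun x hx => ?_
    · simp [IsHermitian, conjTranspose_eq_transpose_of_trivial, hMs]
    · have hpos : 0 < x ⬝ᵥ L *ᵥ x := by simpa using hL.dotProduct_mulVec_pos hx
      rw [star_trivial]
      exact lt_of_lt_of_le (mul_pos (by linarith) hpos) (hle x)
  refine ⟨hpd, ?_⟩
  rw [quadSum, quadSum, Finset.mul_sum]
  refine Finset.sum_le_sum fun i _ => ?_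
  set B := L - η • M with hB
  have uB : IsUnit B.det := (Matrix.isUnit_iff_isUnit_det B).1 hpd.isUnit
  set z := B⁻¹ *ᵥ v i with hz
  have hBz : B *ᵥ z = v i := by rw [hz, mulVec_mulVec, Matrix.mul_nonsing_inv _ uB, one_mulVec]
  have h1 := hle z
  rw [hBz, dotProduct_comm z (v i)] at h1
  have h2 := hL.dotProduct_sq_le (v i) z
  have h3 : 0 ≤ v i ⬝ᵥ z := by
    simpa using hpd.inv.posSemidef.dotProduct_mulVec_nonneg (v i)
  have h4 : 0 ≤ v i ⬝ᵥ L⁻¹ *ᵥ v i := by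
    simpa using hL.inv.posSemidef.dotProduct_mulVec_nonneg (v i)
  rcases h3.eq_or_lt with h | h
  · rw [← h]; simpa using h4
  · refine le_of_mul_le_mul_right ?_ h
    have h5 := mul_le_mul_of_nonneg_left h1 h4
    have h6 : 0 ≤ 1 - η * φ := by linarith
    nlinarith [mul_le_mul_of_nonneg_left h2 h6]

/-- The numerical comparison behind the barrier step: `x` and `y` stand for the changes of the upper
and lower potential, `a` and `b` for the first-order terms bounding them, and `φ`, `ψ` for the
potentials after the barriers have moved. -/
theorem barrier_averages_lt {ε a b x y φ ψ : ℝ} (hε : 0 < ε) (hε' : ε ≤ 1 / 2)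
    (ha : (1 + ε) * a ≤ x) (hb : y ≤ (1 - ε) * b) (hx : 0 < x) (hy : 0 < y) (hφ : φ ≤ ε / 2)
    (hψ : 0 ≤ ψ) (hψ' : (1 - (1 - ε) * (ε / 2)) * ψ ≤ ε / 2) : a / x + φ < b / y - ψ := by
  have h1 : a / x ≤ 1 / (1 + ε) := by
    rw [div_le_div_iff₀ hx (by linarith)]; linarith
  have h2 : 1 / (1 - ε) ≤ b / y := by
    rw [div_le_div_iff₀ (by linarith) hy]; linarith
  have h3 : 1 / (1 + ε) ≤ 1 - ε + ε ^ 2 := by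
    rw [div_le_iff₀ (by linarith)]
    have : 0 < ε ^ 3 := by positivity
    linarith
  have h4 : 1 + ε ≤ 1 / (1 - ε) := by
    rw [le_div_iff₀ (by linarith)]
    have : 0 < ε ^ 2 := by positivity
    linarith
  have h5 : ε ^ 2 ≤ ε / 2 := by nlinarith
  have h6 : ψ ≤ 4 / 7 * ε := by
    have : (1 - ε) * (ε / 2) ≤ 1 / 8 := by
      have := sq_nonneg (ε - 1 / 2)
      linarith
    have := mul_le_mul_of_nonneg_right this hψ
    linarith
  linarith

/-- One step of the barrier method. While both potentials are at most `ε / 2`, the upper barrier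
can be raised by `1 + ε` and the lower barrier by `1 - ε` times the Gram matrix, and a suitable
nonnegative multiple of some `v i (v i)ᵀ` can be added, without increasing the potentials.
Here `U` and `L` are the gaps between the barriers and the current weighted Gram matrix. -/
theorem exists_barrier_step (v : κ → ι → ℝ) {j : κ} (hj : v j ≠ 0) {ε : ℝ} (hε : 0 < ε)
    (hε' : ε ≤ 1 / 2) {U L : Matrix ι ι ℝ} (hU : U.PosDef) (hL : L.PosDef)
    (hUφ : quadSum v U⁻¹ ≤ ε / 2) (hLφ : quadSum v L⁻¹ ≤ ε / 2) :
    ∃ (i : κ) (s : ℝ), 0 ≤ s ∧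
      (U + (1 + ε) • weightedGram v 1 - s • vecMulVec (v i) (v i)).PosDef ∧
      quadSum v (U + (1 + ε) • weightedGram v 1 - s • vecMulVec (v i) (v i))⁻¹ ≤ ε / 2 ∧
      (L - (1 - ε) • weightedGram v 1 + s • vecMulVec (v i) (v i)).PosDef ∧
      quadSum v (L - (1 - ε) • weightedGram v 1 + s • vecMulVec (v i) (v i))⁻¹ ≤ ε / 2 := by
  set M := weightedGram v 1 with hM
  have hMpsd : M.PosSemidef := posSemidef_weightedGram v (by simp)
  have hU' : (U + (1 + ε) • M).PosDef :=
    hU.add_posSemidef (hMpsd.smul (by linarith))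
  have hηφ : (1 - ε) * (ε / 2) ≤ 1 / 8 := by
    have := sq_nonneg (ε - 1 / 2)
    linarith
  obtain ⟨hL', hLφ'⟩ := posDef_sub_smul_weightedGram v hL (by linarith : 0 ≤ 1 - ε) hLφ
    (by linarith)
  rw [← hM] at hL' hLφ'
  obtain ⟨bU, -⟩ := quadSum_inv_sub_bounds v hU hU'
  have hLe : L - (1 - ε) • M + (1 - ε) • M = L := by abel
  obtain ⟨bL, bL'⟩ := quadSum_inv_sub_bounds v hL' (η := 1 - ε) (by rw [← hM, hLe]; exact hL)
  rw [← hM] at bU bL bL'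
  rw [hLe] at bL bL'
  have pU := quadSum_mul_weightedGram_mul_pos v hU'.inv hj
  have pL := quadSum_mul_weightedGram_mul_pos v hL.inv hj
  rw [← hM] at pU pL
  set BU := U + (1 + ε) • M with hBU
  set BL := L - (1 - ε) • M with hBL
  set ΔU := quadSum v U⁻¹ - quadSum v BU⁻¹ with hΔU
  set ΔL := quadSum v BL⁻¹ - quadSum v L⁻¹ with hΔL
  have hΔUpos : 0 < ΔU := lt_of_lt_of_le (mul_pos (by linarith) pU) bU
  have hΔLpos : 0 < ΔL := lt_of_lt_of_le (mul_pos (by linarith) pL) bL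
  have hUnn : 0 ≤ quadSum v BU⁻¹ := quadSum_nonneg v hU'.inv.posSemidef
  have hLnn : 0 ≤ quadSum v BL⁻¹ := quadSum_nonneg v hL'.inv.posSemidef
  -- Averaging over `i`: some index has room between the two admissibility bounds on `1 / s`.
  have hsum : ∑ i, ((v i ⬝ᵥ (BU⁻¹ * M * BU⁻¹) *ᵥ v i) / ΔU + v i ⬝ᵥ BU⁻¹ *ᵥ v i) <
      ∑ i, ((v i ⬝ᵥ (BL⁻¹ * M * BL⁻¹) *ᵥ v i) / ΔL - v i ⬝ᵥ BL⁻¹ *ᵥ v i) := by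
    rw [Finset.sum_add_distrib, Finset.sum_sub_distrib, ← Finset.sum_div, ← Finset.sum_div]
    change quadSum v (BU⁻¹ * M * BU⁻¹) / ΔU + quadSum v BU⁻¹ <
      quadSum v (BL⁻¹ * M * BL⁻¹) / ΔL - quadSum v BL⁻¹
    exact barrier_averages_lt hε hε' bU bL' hΔUpos hΔLpos (by linarith) hLnn (hLφ'.trans hLφ)
  obtain ⟨i, -, hi⟩ := Finset.exists_lt_of_sum_lt hsum
  have hu : 0 ≤ v i ⬝ᵥ (BU⁻¹ * M * BU⁻¹) *ᵥ v i := by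
    have hXs : (BU⁻¹)ᵀ = BU⁻¹ := by simpa using hU'.inv.isHermitian.eq
    have := (hMpsd.conjTranspose_mul_mul_same BU⁻¹).dotProduct_mulVec_nonneg (v i)
    simpa [conjTranspose_eq_transpose_of_trivial, hXs] using this
  have hp : 0 ≤ v i ⬝ᵥ BU⁻¹ *ᵥ v i := by
    simpa using hU'.inv.posSemidef.dotProduct_mulVec_nonneg (v i)
  have hq : 0 ≤ v i ⬝ᵥ BL⁻¹ *ᵥ v i := by
    simpa using hL'.inv.posSemidef.dotProduct_mulVec_nonneg (v i)
  set u := v i ⬝ᵥ (BU⁻¹ * M * BU⁻¹) *ᵥ v i with hudef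
  set l := v i ⬝ᵥ (BL⁻¹ * M * BL⁻¹) *ᵥ v i with hldef
  set p := v i ⬝ᵥ BU⁻¹ *ᵥ v i with hpdef
  set q := v i ⬝ᵥ BL⁻¹ *ᵥ v i with hqdef
  -- With `1 / s = θ` the lower potential returns exactly to its previous value.
  set θ := l / ΔL - q with hθ
  have huΔ : 0 ≤ u / ΔU := div_nonneg hu hΔUpos.le
  have hθpos : 0 < θ := by linarith
  have hsU : 0 < 1 + (-θ⁻¹) * p := by
    have : θ⁻¹ * p < 1 := by
      rw [inv_mul_lt_iff₀ hθpos]; linarith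
    linarith
  have hsL : 0 < 1 + θ⁻¹ * q := by positivity
  have eU : BU - θ⁻¹ • vecMulVec (v i) (v i) = BU + (-θ⁻¹) • vecMulVec (v i) (v i) := by
    rw [neg_smul, sub_eq_add_neg]
  refine ⟨i, θ⁻¹, (inv_pos.2 hθpos).le, ?_, ?_, hL'.add_smul_vecMulVec _ hsL, ?_⟩
  · rw [eU]; exact hU'.add_smul_vecMulVec _ hsU
  · rw [eU, quadSum_inv_add_smul_vecMulVec v hU' _ hsU, ← hM, ← hudef, ← hpdef]
    have : -θ⁻¹ / (1 + -θ⁻¹ * p) * u = -(u / (θ - p)) := by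
      have : θ - p ≠ 0 := by intro h; linarith
      have h1 : 1 + -θ⁻¹ * p = (θ - p) / θ := by field_simp; ring
      rw [h1]; field_simp
    have h2 : u / (θ - p) ≤ ΔU := by
      have h3 : u / ΔU < θ - p := by linarith
      rw [div_lt_iff₀ hΔUpos] at h3
      rw [div_le_iff₀ (by linarith), mul_comm]
      exact h3.le
    linarith
  · rw [quadSum_inv_add_smul_vecMulVec v hL' _ hsL, ← hM, ← hldef, ← hqdef]
    have : θ⁻¹ / (1 + θ⁻¹ * q) * l = ΔL := by
      have h0 : θ + q = l / ΔL := by rw [hθ]; ring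
      have hl : 0 < l := by
        have : 0 < l / ΔL := by linarith
        exact (div_pos_iff_of_pos_right hΔLpos).1 this
      have h1 : 1 + θ⁻¹ * q = (θ + q) / θ := by field_simp
      rw [h1, h0]; field_simp
    linarith

end BarrierStep

/-! ### Dimension-free sparsification -/

section Sparsification

open Matrix

variable {κ ι : Type*} [Fintype κ] [Fintype ι] [DecidableEq ι]

/-- The invariant of the barrier method after `t` steps: the weighted Gram matrix stays strictly
between the barriers `±c H + t (1 ± ε) M`, where `M` is the Gram matrix, and both potentials stay
at most `ε / 2`. -/
theorem exists_weights_between_barriers (v : κ → ι → ℝ) {j : κ} (hj : v j ≠ 0)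
    {H : Matrix ι ι ℝ} (hH : H.PosDef) {ε c : ℝ} (hε : 0 < ε) (hε' : ε ≤ 1 / 2) (hc : 0 < c)
    (hφ : quadSum v (c • H)⁻¹ ≤ ε / 2) (t : ℕ) :
    ∃ s : κ → ℝ, (∀ i, 0 ≤ s i) ∧ {i | s i ≠ 0}.ncard ≤ t ∧
      (c • H + ((t : ℝ) * (1 + ε)) • weightedGram v 1 - weightedGram v s).PosDef ∧
      quadSum v (c • H + ((t : ℝ) * (1 + ε)) • weightedGram v 1 - weightedGram v s)⁻¹ ≤ ε / 2 ∧
      (c • H - ((t : ℝ) * (1 - ε)) • weightedGram v 1 + weightedGram v s).PosDef ∧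
      quadSum v (c • H - ((t : ℝ) * (1 - ε)) • weightedGram v 1 + weightedGram v s)⁻¹ ≤
        ε / 2 := by
  classical
  induction t with
  | zero =>
    have h0 : weightedGram v 0 = 0 := by simp [weightedGram]
    exact ⟨0, by simp, by simp, by simpa [h0] using hH.smul hc, by simpa [h0] using hφ,
      by simpa [h0] using hH.smul hc, by simpa [h0] using hφ⟩
  | succ t ih =>
    obtain ⟨s, hs, hcard, hU, hUφ, hL, hLφ⟩ := ih
    obtain ⟨i, r, hr, h1, h2, h3, h4⟩ := exists_barrier_step v hj hε hε' hU hL hUφ hLφ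
    obtain ⟨s', hs'⟩ : ∃ s' : κ → ℝ, s' = s + Pi.single i r := ⟨_, rfl⟩
    have eU : c • H + ((t : ℝ) * (1 + ε)) • weightedGram v 1 - weightedGram v s +
        (1 + ε) • weightedGram v 1 - r • vecMulVec (v i) (v i) =
        c • H + (((t + 1 : ℕ) : ℝ) * (1 + ε)) • weightedGram v 1 -
          weightedGram v s' := by
      rw [hs', weightedGram_add, weightedGram_single, Nat.cast_succ, add_one_mul (t : ℝ),
        add_smul ((t : ℝ) * (1 + ε))]
      abel
    have eL : c • H - ((t : ℝ) * (1 - ε)) • weightedGram v 1 + weightedGram v s -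
        (1 - ε) • weightedGram v 1 + r • vecMulVec (v i) (v i) =
        c • H - (((t + 1 : ℕ) : ℝ) * (1 - ε)) • weightedGram v 1 +
          weightedGram v s' := by
      rw [hs', weightedGram_add, weightedGram_single, Nat.cast_succ, add_one_mul (t : ℝ),
        add_smul ((t : ℝ) * (1 - ε))]
      abel
    rw [eU] at h1 h2
    rw [eL] at h3 h4
    refine ⟨s', fun l => ?_, ?_, h1, h2, h3, h4⟩
    · rw [hs', Pi.add_apply]
      refine add_nonneg (hs l) ?_
      by_cases h : l = i
      · subst h; rwa [Pi.single_eq_same]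
      · rw [Pi.single_eq_of_ne h]
    · have hsub : {l | s' l ≠ 0} ⊆ insert i {l | s l ≠ 0} := by
        intro l hl
        by_cases h : l = i
        · exact Or.inl h
        · right
          simpa [hs', h] using hl
      exact (Set.ncard_le_ncard hsub (Set.toFinite _)).trans
        ((Set.ncard_insert_le _ _).trans (by omega))

/-- Dimension-free spectral sparsification of a sum of rank-one matrices: the number of nonzero
weights is governed by the effective dimension `∑ i, v i ⬝ᵥ H⁻¹ *ᵥ v i` relative to a positive
definite matrix `H`, and the error is measured against the Gram matrix plus `H`. -/
theorem exists_sparse_weights (v : κ → ι → ℝ) {H : Matrix ι ι ℝ} (hH : H.PosDef) {ε : ℝ}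
    (hε : 0 < ε) (hε' : ε ≤ 1 / 2) {T : ℕ} (hT : 0 < T)
    (h : 2 * quadSum v H⁻¹ ≤ ε ^ 2 * T) :
    ∃ s : κ → ℝ, (∀ i, 0 ≤ s i) ∧ {i | s i ≠ 0}.ncard ≤ T ∧
      ∀ x, |∑ i, (s i - 1) * (v i ⬝ᵥ x) ^ 2| ≤ ε * (∑ i, (v i ⬝ᵥ x) ^ 2 + x ⬝ᵥ H *ᵥ x) := by
  by_cases hv : ∀ j, v j = 0
  · refine ⟨0, by simp, by simp, fun x => ?_⟩
    have : 0 ≤ x ⬝ᵥ H *ᵥ x := by simpa using hH.posSemidef.dotProduct_mulVec_nonneg x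
    simp only [hv, zero_dotProduct]
    simpa using mul_nonneg hε.le this
  push Not at hv
  obtain ⟨j, hj⟩ := hv
  have hT' : (0 : ℝ) < T := by exact_mod_cast hT
  have hc : 0 < ε * T := mul_pos hε hT'
  have hφ : quadSum v ((ε * T) • H)⁻¹ ≤ ε / 2 := by
    have uH : IsUnit H.det := (Matrix.isUnit_iff_isUnit_det H).1 hH.isUnit
    have : ((ε * T) • H)⁻¹ = (ε * T)⁻¹ • H⁻¹ := by
      refine inv_eq_right_inv ?_
      rw [Matrix.smul_mul, Matrix.mul_smul, Matrix.mul_nonsing_inv _ uH, smul_smul,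
        mul_inv_cancel₀ hc.ne', one_smul]
    rw [this, quadSum_smul, inv_mul_le_iff₀ hc]
    linarith
  obtain ⟨s, hs, hcard, hU, -, hL, -⟩ :=
    exists_weights_between_barriers v hj hH hε hε' hc hφ T
  refine ⟨fun i => s i / T, fun i => div_nonneg (hs i) hT'.le, ?_, fun x => ?_⟩
  · refine (Set.ncard_le_ncard (fun i hi => ?_) (Set.toFinite _)).trans hcard
    simp only [Set.mem_ofPred_eq, ne_eq, div_eq_zero_iff, not_or] at hi
    exact hi.1
  · have hU' := hU.posSemidef.dotProduct_mulVec_nonneg x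
    have hL' := hL.posSemidef.dotProduct_mulVec_nonneg x
    simp only [star_trivial, add_mulVec, sub_mulVec, smul_mulVec, dotProduct_add, dotProduct_sub,
      dotProduct_smul, smul_eq_mul, dotProduct_weightedGram_mulVec, Pi.one_apply, one_mul,
      ← pow_two] at hU' hL'
    have e : ∑ i, (s i / T - 1) * (v i ⬝ᵥ x) ^ 2 =
        (∑ i, s i * (v i ⬝ᵥ x) ^ 2) / T - ∑ i, (v i ⬝ᵥ x) ^ 2 := by
      rw [Finset.sum_div, ← Finset.sum_sub_distrib]
      exact Finset.sum_congr rfl fun i _ => by ring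
    rw [e, abs_le]
    set a := ∑ i, s i * (v i ⬝ᵥ x) ^ 2
    set g := ∑ i, (v i ⬝ᵥ x) ^ 2
    set b := x ⬝ᵥ H *ᵥ x
    have ha : a = a / T * T := by field_simp
    constructor
    · refine le_of_mul_le_mul_right ?_ hT'
      linarith
    · refine le_of_mul_le_mul_right ?_ hT'
      linarith

/-- Sparsification with one additional linear constraint on the weights: appending the scalars
`τ i` as a further coordinate of the vectors `v i` makes the weights preserve `∑ i, τ i ^ 2`. -/
theorem exists_sparse_weights_and_sum_sq (v : κ → ι → ℝ) (τ : κ → ℝ) {H : Matrix ι ι ℝ}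
    (hH : H.PosDef) {μ : ℝ} (hμ : 0 < μ) {ε : ℝ} (hε : 0 < ε) (hε' : ε ≤ 1 / 2) {T : ℕ}
    (hT : 0 < T) (h : 2 * (quadSum v H⁻¹ + (∑ i, τ i ^ 2) / μ) ≤ ε ^ 2 * T) :
    ∃ s : κ → ℝ, (∀ i, 0 ≤ s i) ∧ {i | s i ≠ 0}.ncard ≤ T ∧
      (∀ x, |∑ i, (s i - 1) * (v i ⬝ᵥ x) ^ 2| ≤ ε * (∑ i, (v i ⬝ᵥ x) ^ 2 + x ⬝ᵥ H *ᵥ x)) ∧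
      |∑ i, (s i - 1) * τ i ^ 2| ≤ ε * (∑ i, τ i ^ 2 + μ) := by
  let v' : κ → (ι ⊕ Unit) → ℝ := fun i => Sum.elim (v i) fun _ => τ i
  let H' : Matrix (ι ⊕ Unit) (ι ⊕ Unit) ℝ := fromBlocks H 0 0 (μ • 1)
  have uH : IsUnit H.det := (Matrix.isUnit_iff_isUnit_det H).1 hH.isUnit
  have hHs : Hᵀ = H := by simpa using hH.isHermitian.eq
  have quad : ∀ (N : Matrix ι ι ℝ) (c : ℝ) (x : ι → ℝ) (y : Unit → ℝ),
      Sum.elim x y ⬝ᵥ fromBlocks N 0 0 (c • 1) *ᵥ Sum.elim x y =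
        x ⬝ᵥ N *ᵥ x + c * y () ^ 2 := by
    intro N c x y
    rw [fromBlocks_mulVec]
    simp [smul_mulVec, dotProduct]
    ring
  have hH' : H'.PosDef := by
    refine PosDef.of_dotProduct_mulVec_pos ?_ fun z hz => ?_
    · simp [H', IsHermitian, conjTranspose_eq_transpose_of_trivial, fromBlocks_transpose, hHs]
    · obtain ⟨x, y, rfl⟩ : ∃ x y, z = Sum.elim x y :=
        ⟨z ∘ Sum.inl, z ∘ Sum.inr, (Sum.elim_comp_inl_inr z).symm⟩
      rw [star_trivial, quad]
      by_cases hx : x = 0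
      · have hy : y () ≠ 0 := by
          intro hy
          refine hz ?_
          ext (i | i)
          · simp [hx]
          · simpa using hy
        subst hx
        simpa using mul_pos hμ (pow_pos (abs_pos.2 hy) 2)
      · have h1 : 0 < x ⬝ᵥ H *ᵥ x := by simpa using hH.dotProduct_mulVec_pos hx
        positivity
  have hinv : H'⁻¹ = fromBlocks H⁻¹ 0 0 (μ⁻¹ • 1) := by
    refine inv_eq_right_inv ?_
    simp [H', fromBlocks_multiply, Matrix.mul_nonsing_inv _ uH, smul_smul, hμ.ne']
  have hq : quadSum v' H'⁻¹ = quadSum v H⁻¹ + (∑ i, τ i ^ 2) / μ := by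
    simp only [quadSum, hinv, v', quad, Finset.sum_add_distrib, Finset.sum_div]
    simp [div_eq_inv_mul]
  obtain ⟨s, hs, hcard, hsx⟩ := exists_sparse_weights v' hH' hε hε' hT (by rwa [hq])
  refine ⟨s, hs, hcard, fun x => ?_, ?_⟩
  · have := hsx (Sum.elim x 0)
    rw [quad] at this
    simpa [v', sumElim_dotProduct_sumElim] using this
  · have := hsx (Sum.elim 0 1)
    rw [quad] at this
    simpa [v', sumElim_dotProduct_sumElim] using this

/-- The effective dimension `∑ i, v i ⬝ᵥ (M + c)⁻¹ *ᵥ v i`, where `M` is the Gram matrix, is at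
most `k` plus the residual of the family outside any `k`-dimensional subspace divided by `c`.
The columns of `P` form an orthonormal basis of the subspace. -/
theorem quadSum_ridge_inv_le (v : κ → ι → ℝ) {c : ℝ} (hc : 0 < c) {ν : Type*} [Fintype ν]
    [DecidableEq ν] (P : Matrix ι ν ℝ) (hP : Pᵀ * P = 1) :
    quadSum v (weightedGram v 1 + c • (1 : Matrix ι ι ℝ))⁻¹ ≤
      Fintype.card ν + quadSum v (1 - P * Pᵀ) / c := by
  have tr : ∀ N, quadSum v N = trace (weightedGram v 1 * N) := by
    intro N
    simp [quadSum, weightedGram, Matrix.sum_mul, trace_sum, vecMulVec_mul, trace_vecMulVec,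
      dotProduct_mulVec, dotProduct_comm]
  set M := weightedGram v 1 with hM
  have hMs : Mᵀ = M := weightedGram_transpose v 1
  have hMpsd : M.PosSemidef := posSemidef_weightedGram v (by simp)
  have hH : (M + c • (1 : Matrix ι ι ℝ)).PosDef :=
    PosDef.posSemidef_add hMpsd (PosDef.one.smul hc)
  have uH := (Matrix.isUnit_iff_isUnit_det _).1 hH.isUnit
  set X := (M + c • (1 : Matrix ι ι ℝ))⁻¹ with hX
  have hXpsd : X.PosSemidef := hH.inv.posSemidef
  have e1 : M * X = 1 - c • X := by
    have := Matrix.mul_nonsing_inv _ uH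
    rw [Matrix.add_mul, ← hX, Matrix.smul_mul, Matrix.one_mul] at this
    rw [← this]; abel
  have e1' : X * M = 1 - c • X := by
    have := Matrix.nonsing_inv_mul _ uH
    rw [Matrix.mul_add, ← hX, Matrix.mul_smul, Matrix.mul_one] at this
    rw [← this]; abel
  -- `M X` is dominated by `c⁻¹ M`, as `M X M` is positive semidefinite.
  have e2 : M - c • (M * X) = M * X * M := by
    rw [Matrix.mul_assoc, e1', Matrix.mul_sub, Matrix.mul_one, Matrix.mul_smul]
  set F : Matrix ι ι ℝ := 1 - P * Pᵀ with hF
  have hFs : Fᵀ = F := by simp [hF, transpose_mul]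
  have hFF : F * F = F := by
    have : P * Pᵀ * (P * Pᵀ) = P * Pᵀ := by
      rw [Matrix.mul_assoc, ← Matrix.mul_assoc Pᵀ, hP, Matrix.one_mul]
    rw [hF, Matrix.mul_sub, Matrix.sub_mul, Matrix.sub_mul, this]; simp
  -- On the subspace, `M X = 1 - c X` is at most the identity.
  have h1 : trace (M * X * (P * Pᵀ)) ≤ Fintype.card ν := by
    have hnn : 0 ≤ trace (X * (P * Pᵀ)) := by
      have := (hXpsd.conjTranspose_mul_mul_same P).trace_nonneg
      rwa [conjTranspose_eq_transpose_of_trivial, Matrix.mul_assoc, trace_mul_comm,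
        Matrix.mul_assoc] at this
    rw [e1, Matrix.sub_mul, trace_sub, Matrix.one_mul, Matrix.smul_mul, trace_smul,
      trace_mul_comm P, hP, trace_one, smul_eq_mul]
    have := mul_nonneg hc.le hnn
    linarith
  have h2 : trace (M * X * F) ≤ trace (M * F) / c := by
    have hnn : 0 ≤ trace (M * X * M * F) := by
      have hp : (M * X * M).PosSemidef := by
        have := hXpsd.conjTranspose_mul_mul_same M
        rwa [conjTranspose_eq_transpose_of_trivial, hMs] at this
      have := (hp.conjTranspose_mul_mul_same F).trace_nonneg
      rwa [conjTranspose_eq_transpose_of_trivial, hFs, Matrix.mul_assoc, trace_mul_comm,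
        Matrix.mul_assoc, hFF] at this
    rw [← e2, Matrix.sub_mul, trace_sub, Matrix.smul_mul, trace_smul, smul_eq_mul] at hnn
    rw [le_div_iff₀ hc]
    linarith
  rw [tr, tr]
  have : M * X = M * X * (P * Pᵀ) + M * X * F := by
    rw [← Matrix.mul_add, hF, add_sub_cancel, Matrix.mul_one]
  rw [this, trace_add]
  exact add_le_add h1 h2

end Sparsification

/-! ### Orthogonal projections and residuals -/

section Projections

variable {E : Type*} [NormedAddCommGroup E] [InnerProductSpace ℝ E] [FiniteDimensional ℝ E]

theorem norm_sq_starProjection_of_le {P R : Submodule ℝ E} (h : P ≤ R) (a : E) :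
    ‖R.starProjection a‖ ^ 2 =
      ‖P.starProjection a‖ ^ 2 + ‖(Pᗮ ⊓ R).starProjection a‖ ^ 2 := by
  have h1 : P.starProjection (R.starProjection a) = P.starProjection a :=
    congrArg (fun f => f a) (Submodule.starProjection_comp_starProjection_of_le h)
  have h2 : Pᗮ.starProjection (R.starProjection a) = (Pᗮ ⊓ R).starProjection a := by
    have e : Pᗮ.starProjection (R.starProjection a) =
        R.starProjection a - P.starProjection a := by
      rw [← h1, eq_sub_iff_add_eq', Submodule.starProjection_add_starProjection_orthogonal]
    refine (Submodule.eq_starProjection_of_mem_of_inner_eq_zero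
      (Submodule.mem_inf.2 ⟨?_, ?_⟩) ?_).symm
    · exact Submodule.starProjection_apply_mem _ _
    · rw [e]
      exact sub_mem (Submodule.starProjection_apply_mem _ _)
        (h (Submodule.starProjection_apply_mem _ _))
    · intro w hw
      rw [e, sub_sub_eq_add_sub, add_sub_right_comm, inner_add_left,
        Submodule.starProjection_inner_eq_zero _ _ hw.2, zero_add]
      exact hw.1 _ (Submodule.starProjection_apply_mem _ _)
  rw [Submodule.norm_sq_eq_add_norm_sq_starProjection (R.starProjection a) P, h1, h2]

theorem norm_sq_starProjection_eq_sum_inner (W : Submodule ℝ E) {ν : Type*} [Fintype ν]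
    (b : OrthonormalBasis ν ℝ W) (a : E) :
    ‖W.starProjection a‖ ^ 2 = ∑ l, inner ℝ (b l : E) a ^ 2 := by
  have : ‖W.starProjection a‖ = ‖W.orthogonalProjectionOnto a‖ := rfl
  rw [this, ← b.sum_sq_inner_right]
  refine Finset.sum_congr rfl fun l _ => ?_
  rw [Submodule.inner_orthogonalProjectionOnto_eq_of_mem_left]

theorem infDist_eq_norm_orthogonal_starProjection (S : Submodule ℝ E) (a : E) :
    Metric.infDist a (S : Set E) = ‖Sᗮ.starProjection a‖ := by
  rw [Metric.infDist_eq_iInf, Submodule.starProjection_orthogonal_val,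
    Submodule.starProjection_minimal]
  simp [dist_eq_norm]

/-- The residual of `a` after projection to `S` differs from that after projection to `Q` by two
projections to subspaces of `Q ⊔ S` of dimension at most `dim Q` and `dim S`. -/
theorem norm_sq_orthogonal_starProjection_eq (Q S : Submodule ℝ E) (a : E) :
    ‖Sᗮ.starProjection a‖ ^ 2 = ‖Qᗮ.starProjection a‖ ^ 2 -
      ‖(Qᗮ ⊓ (Q ⊔ S)).starProjection a‖ ^ 2 + ‖(Sᗮ ⊓ (Q ⊔ S)).starProjection a‖ ^ 2 := by
  have h1 := norm_sq_starProjection_of_le (le_sup_left : Q ≤ Q ⊔ S) a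
  have h2 := norm_sq_starProjection_of_le (le_sup_right : S ≤ Q ⊔ S) a
  have h3 := Submodule.norm_sq_eq_add_norm_sq_starProjection a Q
  have h4 := Submodule.norm_sq_eq_add_norm_sq_starProjection a S
  linarith

theorem finrank_orthogonal_inf_sup_le (Q S : Submodule ℝ E) :
    Module.finrank ℝ (Qᗮ ⊓ (Q ⊔ S) : Submodule ℝ E) ≤ Module.finrank ℝ S := by
  have h1 := Submodule.finrank_add_inf_finrank_orthogonal (le_sup_left : Q ≤ Q ⊔ S)
  have h2 := Submodule.finrank_add_le_finrank_add_finrank Q S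
  omega

variable {κ : Type*} [Fintype κ]

/-- An error bound for the quadratic form of a weighted family in single directions adds up, over
an orthonormal basis, to an error bound for projections to a subspace. -/
theorem abs_sum_sub_one_mul_starProjection_le (p : κ → E) {s : κ → ℝ} {ε c : ℝ}
    (h : ∀ x, |∑ i, (s i - 1) * inner ℝ x (p i) ^ 2| ≤
      ε * (2 * ∑ i, inner ℝ x (p i) ^ 2 + c * ‖x‖ ^ 2)) (W : Submodule ℝ E) :
    |∑ i, (s i - 1) * ‖W.starProjection (p i)‖ ^ 2| ≤
      ε * (2 * ∑ i, ‖W.starProjection (p i)‖ ^ 2 + c * Module.finrank ℝ W) := by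
  let b := stdOrthonormalBasis ℝ W
  simp only [norm_sq_starProjection_eq_sum_inner W b, Finset.mul_sum]
  rw [Finset.sum_comm]
  refine (Finset.abs_sum_le_sum_abs _ _).trans ((Finset.sum_le_sum fun l _ => h (b l)).trans ?_)
  have hb : ∀ l, ‖(b l : E)‖ = 1 := fun l => b.norm_eq_one l
  simp only [hb, ← Finset.mul_sum, Finset.sum_add_distrib]
  rw [Finset.sum_comm]
  simp

theorem sum_sq_starProjection_le_of_le (p : κ → E) {P R : Submodule ℝ E} (h : P ≤ R) :
    ∑ i, ‖P.starProjection (p i)‖ ^ 2 ≤ ∑ i, ‖R.starProjection (p i)‖ ^ 2 :=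
  Finset.sum_le_sum fun i _ => by
    rw [norm_sq_starProjection_of_le h]; nlinarith [sq_nonneg ‖(Pᗮ ⊓ R).starProjection (p i)‖]

/-- If the weights preserve the residual of a `k`-dimensional subspace `Q` and the quadratic form
of the family up to a ridge term, they preserve the residual of every `k`-dimensional subspace. -/
theorem abs_sum_sub_one_mul_orthogonal_le (p : κ → E) {s : κ → ℝ} {ε c : ℝ} (hε : 0 ≤ ε)
    (hc : 0 ≤ c)
    (h : ∀ x, |∑ i, (s i - 1) * inner ℝ x (p i) ^ 2| ≤
      ε * (2 * ∑ i, inner ℝ x (p i) ^ 2 + c * ‖x‖ ^ 2)) {k : ℕ} {Q S : Submodule ℝ E}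
    (hQ : Module.finrank ℝ Q = k) (hS : Module.finrank ℝ S = k)
    (hQc : ∑ i, ‖Qᗮ.starProjection (p i)‖ ^ 2 ≤ c * k)
    (hQs : |∑ i, (s i - 1) * ‖Qᗮ.starProjection (p i)‖ ^ 2| ≤ ε * (2 * (c * k))) :
    |∑ i, (s i - 1) * ‖Sᗮ.starProjection (p i)‖ ^ 2| ≤
      ε * (6 * (c * k) + 2 * ∑ i, ‖Sᗮ.starProjection (p i)‖ ^ 2) := by
  have e : ∑ i, (s i - 1) * ‖Sᗮ.starProjection (p i)‖ ^ 2 =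
      ∑ i, (s i - 1) * ‖Qᗮ.starProjection (p i)‖ ^ 2 -
      ∑ i, (s i - 1) * ‖(Qᗮ ⊓ (Q ⊔ S)).starProjection (p i)‖ ^ 2 +
      ∑ i, (s i - 1) * ‖(Sᗮ ⊓ (Q ⊔ S)).starProjection (p i)‖ ^ 2 := by
    rw [← Finset.sum_sub_distrib, ← Finset.sum_add_distrib]
    refine Finset.sum_congr rfl fun i _ => ?_
    rw [norm_sq_orthogonal_starProjection_eq Q S]; ring
  have h1 := abs_sum_sub_one_mul_starProjection_le p h (Qᗮ ⊓ (Q ⊔ S))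
  have h2 := abs_sum_sub_one_mul_starProjection_le p h (Sᗮ ⊓ (Q ⊔ S))
  have l1 := sum_sq_starProjection_le_of_le p (inf_le_left : Qᗮ ⊓ (Q ⊔ S) ≤ Qᗮ)
  have l2 := sum_sq_starProjection_le_of_le p (inf_le_left : Sᗮ ⊓ (Q ⊔ S) ≤ Sᗮ)
  have d1 : (Module.finrank ℝ (Qᗮ ⊓ (Q ⊔ S) : Submodule ℝ E) : ℝ) ≤ k := by
    have := finrank_orthogonal_inf_sup_le Q S
    exact_mod_cast hS ▸ this
  have d2 : (Module.finrank ℝ (Sᗮ ⊓ (Q ⊔ S) : Submodule ℝ E) : ℝ) ≤ k := by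
    have := finrank_orthogonal_inf_sup_le S Q
    rw [sup_comm] at this
    exact_mod_cast hQ ▸ this
  have m1 := mul_le_mul_of_nonneg_left d1 hc
  have m2 := mul_le_mul_of_nonneg_left d2 hc
  have b1 := h1.trans (mul_le_mul_of_nonneg_left (a := ε)
    (show _ ≤ 2 * (c * k) + c * k by linarith) hε)
  have b2 := h2.trans (mul_le_mul_of_nonneg_left (a := ε)
    (show _ ≤ 2 * ∑ i, ‖Sᗮ.starProjection (p i)‖ ^ 2 + c * k by linarith) hε)
  rw [e]
  refine (abs_add_le _ _).trans ((add_le_add_left ((abs_sub _ _).trans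
    (add_le_add hQs b1)) _).trans ((add_le_add_right b2 _).trans (le_of_eq ?_)))
  ring

/-- The sum of the squared distances to a `k`-dimensional subspace attains its minimum, because
the set of orthonormal `k`-frames is compact. -/
theorem exists_forall_sum_sq_orthogonal_le (p : κ → E) {k : ℕ} (hk : k ≤ Module.finrank ℝ E) :
    ∃ Q : Submodule ℝ E, Module.finrank ℝ Q = k ∧ ∀ S : Submodule ℝ E, Module.finrank ℝ S = k →
      ∑ i, ‖Qᗮ.starProjection (p i)‖ ^ 2 ≤ ∑ i, ‖Sᗮ.starProjection (p i)‖ ^ 2 := by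
  let F : (Fin k → E) → ℝ := fun f => ∑ i, (‖p i‖ ^ 2 - ∑ l, inner ℝ (f l) (p i) ^ 2)
  let K : Set (Fin k → E) := {f | Orthonormal ℝ f}
  have hKc : IsCompact K := by
    refine Metric.isCompact_of_isClosed_isBounded ?_ ?_
    · have : K = ⋂ i, ⋂ j, {f : Fin k → E | inner ℝ (f i) (f j) = if i = j then (1 : ℝ) else 0} := by
        ext f
        simp [K, orthonormal_iff_ite]
      rw [this]
      exact isClosed_iInter fun i => isClosed_iInter fun j =>
        isClosed_eq (by fun_prop) continuous_const
    · refine (Metric.isBounded_closedBall (x := (0 : Fin k → E)) (r := 1)).subset fun f hf => ?_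
      rw [mem_closedBall_zero_iff, pi_norm_le_iff_of_nonneg zero_le_one]
      exact fun l => (Orthonormal.norm_eq_one hf l).le
  have hFc : Continuous F := by fun_prop
  have hbasis : ∀ (S : Submodule ℝ E) (b : OrthonormalBasis (Fin k) ℝ S),
      F (fun l => (b l : E)) = ∑ i, ‖Sᗮ.starProjection (p i)‖ ^ 2 := by
    intro S b
    refine Finset.sum_congr rfl fun i _ => ?_
    rw [← norm_sq_starProjection_eq_sum_inner S b,
      Submodule.norm_sq_eq_add_norm_sq_starProjection (p i) S]
    ring
  have horth : ∀ (S : Submodule ℝ E) (b : OrthonormalBasis (Fin k) ℝ S),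
      (fun l => (b l : E)) ∈ K := fun S b =>
    b.orthonormal.comp_linearIsometry S.subtypeₗᵢ
  have hKn : K.Nonempty := by
    refine ⟨fun l => stdOrthonormalBasis ℝ E (Fin.castLE hk l), ?_⟩
    exact (stdOrthonormalBasis ℝ E).orthonormal.comp _ (Fin.castLE_injective hk)
  obtain ⟨f, hf, hmin⟩ := hKc.exists_isMinOn hKn hFc.continuousOn
  have hf' : Orthonormal ℝ f := hf
  let Q := Submodule.span ℝ (Set.range f)
  have hQ : Module.finrank ℝ Q = k := by
    simpa using finrank_span_eq_card hf'.linearIndependent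
  have hfQ : ∃ b : OrthonormalBasis (Fin k) ℝ Q, ∀ l, (b l : E) = f l := by
    have hm : ∀ l, f l ∈ Q := fun l => Submodule.subset_span (Set.mem_range_self l)
    have ho : Orthonormal ℝ (fun l => (⟨f l, hm l⟩ : Q)) := by
      rw [orthonormal_iff_ite] at hf' ⊢
      exact hf'
    refine ⟨OrthonormalBasis.mk ho ?_, fun l => by rw [OrthonormalBasis.coe_mk]⟩
    rw [top_le_iff]
    exact ho.linearIndependent.span_eq_top_of_card_eq_finrank' (by simp [hQ])
  obtain ⟨b, hb⟩ := hfQ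
  refine ⟨Q, hQ, fun S hS => ?_⟩
  let bS : OrthonormalBasis (Fin k) ℝ S := (stdOrthonormalBasis ℝ S).reindex (finCongr hS)
  rw [← hbasis S bS, ← hbasis Q b]
  simp only [hb]
  exact hmin (horth S bS)

/-- On the span of a finite family, its quadratic form is bounded below by a multiple of the
squared norm. -/
theorem exists_pos_mul_norm_sq_le_sum_inner_sq (p : κ → E) :
    ∃ c : ℝ, 0 < c ∧ ∀ x ∈ Submodule.span ℝ (Set.range p),
      c * ‖x‖ ^ 2 ≤ ∑ i, inner ℝ x (p i) ^ 2 := by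
  let W := Submodule.span ℝ (Set.range p)
  let f : W →ₗ[ℝ] EuclideanSpace ℝ κ :=
    { toFun := fun x => WithLp.toLp 2 fun i => inner ℝ (x : E) (p i)
      map_add' := fun x y => by ext i; simp [inner_add_left]
      map_smul' := fun c x => by ext i; simp [inner_smul_left] }
  have hf : LinearMap.ker f = ⊥ := by
    rw [LinearMap.ker_eq_bot']
    intro x hx
    have hx' : ∀ i, inner ℝ (x : E) (p i) = 0 := fun i => by
      have := congrArg (fun y : EuclideanSpace ℝ κ => y i) hx
      simpa [f] using this
    have hle : W ≤ (Submodule.span ℝ {(x : E)})ᗮ := by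
      refine Submodule.span_le.2 ?_
      rintro _ ⟨i, rfl⟩
      exact Submodule.mem_orthogonal_singleton_iff_inner_right.2 (hx' i)
    have := Submodule.mem_orthogonal_singleton_iff_inner_right.1 (hle x.2)
    simpa using this
  obtain ⟨K, hK, hanti⟩ := f.exists_antilipschitzWith hf
  have hK' : (0 : ℝ) < K := hK
  refine ⟨(K : ℝ)⁻¹ ^ 2, by positivity, fun x hx => ?_⟩
  have h1 : ‖x‖ ≤ K * ‖f ⟨x, hx⟩‖ := by
    simpa using hanti.le_mul_dist ⟨x, hx⟩ 0
  have h2 : ‖f ⟨x, hx⟩‖ ^ 2 = ∑ i, inner ℝ x (p i) ^ 2 := by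
    rw [EuclideanSpace.norm_sq_eq]; simp [f]
  rw [← h2, ← mul_pow]
  refine pow_le_pow_left₀ (by positivity) ?_ 2
  rwa [inv_mul_le_iff₀ hK']

end Projections

/-! ### Coresets -/

section Coresets

open Matrix

theorem inner_eq_ofLp_dotProduct {ι : Type*} [Fintype ι] (x y : EuclideanSpace ℝ ι) :
    inner ℝ x y = y.ofLp ⬝ᵥ x.ofLp := by
  rw [EuclideanSpace.inner_eq_star_dotProduct, star_trivial]

/-- The residual of a family of points outside `Q`, as a value of `quadSum`. -/
theorem quadSum_one_sub_mul_transpose {κ ι ν : Type*} [Fintype κ] [Fintype ι] [DecidableEq ι]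
    [Fintype ν] (p : κ → EuclideanSpace ℝ ι) (Q : Submodule ℝ (EuclideanSpace ℝ ι))
    (b : OrthonormalBasis ν ℝ Q) :
    quadSum (fun i => (p i).ofLp) (1 - (of fun x l => (b l : EuclideanSpace ℝ ι) x) *
        (of fun x l => (b l : EuclideanSpace ℝ ι) x)ᵀ) =
      ∑ i, ‖Qᗮ.starProjection (p i)‖ ^ 2 := by
  refine Finset.sum_congr rfl fun i _ => ?_
  have h1 := Submodule.norm_sq_eq_add_norm_sq_starProjection (p i) Q
  rw [norm_sq_starProjection_eq_sum_inner Q b] at h1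
  have h2 : ((of fun x l => (b l : EuclideanSpace ℝ ι) x)ᵀ *ᵥ (p i).ofLp : ν → ℝ) =
      fun l => inner ℝ (b l : EuclideanSpace ℝ ι) (p i) := by
    ext l
    rw [inner_eq_ofLp_dotProduct, dotProduct_comm]
    rfl
  rw [sub_mulVec, dotProduct_sub, one_mulVec, ← inner_eq_ofLp_dotProduct,
    real_inner_self_eq_norm_sq, h1, ← mulVec_mulVec, dotProduct_mulVec, ← mulVec_transpose, h2]
  simp [dotProduct, pow_two]

/-- Sparse weights that control both quantities needed for a coreset: the quadratic form of the
points up to the ridge `c`, and the residual of one subspace `Q`. The effective dimension of the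
points is at most `2 k`, and the constraint for `Q` adds at most `1`. -/
theorem exists_sparse_weights_of_sum_sq_orthogonal_le {κ ι : Type*} [Fintype κ] [Fintype ι]
    [DecidableEq ι] (p : κ → EuclideanSpace ℝ ι) {k : ℕ} (hk : 1 ≤ k)
    {ε c : ℝ} (hε : 0 < ε) (hε' : ε ≤ 1 / 2) (hc : 0 < c) {T : ℕ}
    (hT : 2 * (2 * k + 1) ≤ ε ^ 2 * T) {Q : Submodule ℝ (EuclideanSpace ℝ ι)}
    (hQ : Module.finrank ℝ Q = k)
    (hQc : ∑ i, ‖Qᗮ.starProjection (p i)‖ ^ 2 ≤ c * k) :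
    ∃ s : κ → ℝ, (∀ i, 0 ≤ s i) ∧ {i | s i ≠ 0}.ncard ≤ T ∧
      (∀ x, |∑ i, (s i - 1) * inner ℝ x (p i) ^ 2| ≤
        ε * (2 * ∑ i, inner ℝ x (p i) ^ 2 + c * ‖x‖ ^ 2)) ∧
      |∑ i, (s i - 1) * ‖Qᗮ.starProjection (p i)‖ ^ 2| ≤ ε * (2 * (c * k)) := by
  have hk' : (0 : ℝ) < k := by exact_mod_cast hk
  have hT0 : 0 < T := by
    rcases Nat.eq_zero_or_pos T with rfl | h
    · norm_num at hT; linarith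
    · exact h
  let b : OrthonormalBasis (Fin k) ℝ Q := (stdOrthonormalBasis ℝ Q).reindex (finCongr hQ)
  let P : Matrix ι (Fin k) ℝ := of fun x l => (b l : EuclideanSpace ℝ ι) x
  have hP : Pᵀ * P = 1 := by
    ext l m
    have := orthonormal_iff_ite.1 b.orthonormal l m
    rw [Submodule.coe_inner, inner_eq_ofLp_dotProduct] at this
    rw [Matrix.one_apply, ← this]
    simp [P, mul_apply, dotProduct, mul_comm]
  have hMpsd : (weightedGram (fun i => (p i).ofLp) 1).PosSemidef :=
    posSemidef_weightedGram (fun i => (p i).ofLp) (by simp)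
  have hH : (weightedGram (fun i => (p i).ofLp) 1 + c • (1 : Matrix ι ι ℝ)).PosDef :=
    PosDef.posSemidef_add hMpsd (PosDef.one.smul hc)
  have hμ : 0 < c * k := mul_pos hc hk'
  have hdim := quadSum_ridge_inv_le (fun i => (p i).ofLp) hc P hP
  rw [quadSum_one_sub_mul_transpose p Q b, Fintype.card_fin] at hdim
  have h1 : (∑ i, ‖Qᗮ.starProjection (p i)‖ ^ 2) / c ≤ k := by
    rw [div_le_iff₀ hc]; linarith
  have h2 : (∑ i, ‖Qᗮ.starProjection (p i)‖ ^ 2) / (c * k) ≤ 1 := by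
    rw [div_le_iff₀ hμ]; linarith
  obtain ⟨s, hs, hcard, hx, hτ⟩ := exists_sparse_weights_and_sum_sq (fun i => (p i).ofLp)
    (fun i => ‖Qᗮ.starProjection (p i)‖) hH hμ hε hε' hT0 (by linarith)
  refine ⟨s, hs, hcard, fun x => ?_, hτ.trans (mul_le_mul_of_nonneg_left (by linarith) hε.le)⟩
  simp only [inner_eq_ofLp_dotProduct]
  refine (hx x.ofLp).trans (le_of_eq ?_)
  have h3 : x.ofLp ⬝ᵥ x.ofLp = ‖x‖ ^ 2 := by
    rw [← real_inner_self_eq_norm_sq, inner_eq_ofLp_dotProduct]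
  rw [add_mulVec, dotProduct_add, dotProduct_weightedGram_mulVec, smul_mulVec, one_mulVec,
    dotProduct_smul, h3, smul_eq_mul]
  simp only [Pi.one_apply, one_mul, ← pow_two]
  ring

/-- The weights `s` of the quadratic form correspond to the weights `√s` of the rows. -/
theorem isCoreset_sqrt {n d : ℕ} {A : Matrix (Fin n) (Fin d) ℝ} {ε : ℝ} {k : ℕ}
    {s : Fin n → ℝ} (hs : ∀ i, 0 ≤ s i)
    (h : ∀ S : Submodule ℝ (EuclideanSpace ℝ (Fin d)), Module.finrank ℝ S = k →
      |∑ i, (s i - 1) * ‖Sᗮ.starProjection (rowPoint A i)‖ ^ 2| ≤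
        ε * ∑ i, ‖Sᗮ.starProjection (rowPoint A i)‖ ^ 2) :
    IsCoreset A ε k (fun i => √(s i)) := by
  refine ⟨fun i => Real.sqrt_nonneg _, fun S hS => ?_⟩
  simp only [sumSqDist, infDist_eq_norm_orthogonal_starProjection]
  refine le_trans (le_of_eq ?_) (h S hS)
  rw [abs_sub_comm, ← Finset.sum_sub_distrib]
  congr 1
  refine Finset.sum_congr rfl fun i _ => ?_
  rw [map_smul, norm_smul, mul_pow, Real.norm_eq_abs, sq_abs, Real.sq_sqrt (hs i)]
  ring

theorem sparsity_sqrt {n : ℕ} {s : Fin n → ℝ} (hs : ∀ i, 0 ≤ s i) :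
    sparsity (fun i => √(s i)) = {i | s i ≠ 0}.ncard := by
  simp [sparsity, Real.sqrt_eq_zero (hs _)]

/-- The coreset when the rows lie in a `k`-dimensional subspace. The ridge parameter is chosen so
small that the ridge term is dominated by the quadratic form on the span of the rows. -/
theorem exists_coreset_of_forall_mem {n d : ℕ} (A : Matrix (Fin n) (Fin d) ℝ)
    {k : ℕ} (hk : 1 ≤ k) {ε : ℝ} (hε : 0 < ε) (hε' : ε ≤ 1 / 2) {T : ℕ}
    (hT : 2 * (2 * k + 1) ≤ ε ^ 2 * T) {Q : Submodule ℝ (EuclideanSpace ℝ (Fin d))}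
    (hQ : Module.finrank ℝ Q = k)
    (hQ0 : ∑ i, ‖Qᗮ.starProjection (rowPoint A i)‖ ^ 2 = 0) :
    ∃ w : Fin n → ℝ, IsCoreset A (8 * ε) k w ∧ sparsity w ≤ T := by
  obtain ⟨c, hc, hcx⟩ := exists_pos_mul_norm_sq_le_sum_inner_sq (rowPoint A)
  obtain ⟨s, hs, hcard, hx, -⟩ := exists_sparse_weights_of_sum_sq_orthogonal_le (rowPoint A) hk hε hε' hc hT
    hQ (by rw [hQ0]; positivity)
  refine ⟨_, isCoreset_sqrt hs fun S _ => ?_, (sparsity_sqrt hs).trans_le hcard⟩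
  have hx' : ∀ x, |∑ i, (s i - 1) * inner ℝ x (rowPoint A i) ^ 2| ≤
      (3 / 2 * ε) * (2 * ∑ i, inner ℝ x (rowPoint A i) ^ 2 + 0 * ‖x‖ ^ 2) := by
    intro x
    let W := Submodule.span ℝ (Set.range (rowPoint A))
    have hW : ∀ i, inner ℝ (W.starProjection x) (rowPoint A i) = inner ℝ x (rowPoint A i) := by
      intro i
      have := Submodule.starProjection_inner_eq_zero (K := W) x (rowPoint A i)
        (Submodule.subset_span (Set.mem_range_self i))
      rw [inner_sub_left] at this
      linarith
    have h1 := hx (W.starProjection x)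
    have h2 := hcx _ (Submodule.starProjection_apply_mem W x)
    simp only [hW] at h1 h2
    refine h1.trans ((mul_le_mul_of_nonneg_left (add_le_add_right h2 _) hε.le).trans
      (le_of_eq ?_))
    ring
  refine (abs_sum_sub_one_mul_starProjection_le _ hx' Sᗮ).trans ?_
  have : 0 ≤ ε * ∑ i, ‖Sᗮ.starProjection (rowPoint A i)‖ ^ 2 :=
    mul_nonneg hε.le (Finset.sum_nonneg fun i _ => sq_nonneg _)
  linarith

theorem exists_coreset_sparsity_le {n d : ℕ} (A : Matrix (Fin n) (Fin d) ℝ)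
    {k : ℕ} (hk : 1 ≤ k) {ε : ℝ} (hε : 0 < ε) (hε' : ε ≤ 1 / 2) {T : ℕ}
    (hT : 2 * (2 * k + 1) ≤ ε ^ 2 * T) :
    ∃ w : Fin n → ℝ, IsCoreset A (8 * ε) k w ∧ sparsity w ≤ T := by
  have hk' : (0 : ℝ) < k := by exact_mod_cast hk
  rcases le_or_gt k (Module.finrank ℝ (EuclideanSpace ℝ (Fin d))) with hkd | hkd
  · obtain ⟨Q, hQ, hmin⟩ := exists_forall_sum_sq_orthogonal_le (rowPoint A) hkd
    have hnn : 0 ≤ ∑ i, ‖Qᗮ.starProjection (rowPoint A i)‖ ^ 2 :=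
      Finset.sum_nonneg fun i _ => sq_nonneg _
    rcases hnn.eq_or_lt with h0 | hpos
    · exact exists_coreset_of_forall_mem A hk hε hε' hT hQ h0.symm
    · -- The ridge parameter is the minimal residual per dimension.
      have hc : (∑ i, ‖Qᗮ.starProjection (rowPoint A i)‖ ^ 2) / k * k =
          ∑ i, ‖Qᗮ.starProjection (rowPoint A i)‖ ^ 2 := by field_simp
      have hcpos := div_pos hpos hk'
      obtain ⟨s, hs, hcard, hx, hQs⟩ := exists_sparse_weights_of_sum_sq_orthogonal_le (rowPoint A) hk hε hε'
        hcpos hT hQ hc.ge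
      refine ⟨_, isCoreset_sqrt hs fun S hS => ?_, (sparsity_sqrt hs).trans_le hcard⟩
      refine (abs_sum_sub_one_mul_orthogonal_le _ hε.le hcpos.le hx hQ hS hc.ge hQs).trans ?_
      rw [hc]
      have := mul_le_mul_of_nonneg_left (hmin S hS) hε.le
      linarith
  · -- There are no `k`-dimensional subspaces.
    refine ⟨0, ⟨fun i => le_rfl, fun S hS => ?_⟩, by simp [sparsity]⟩
    have := Submodule.finrank_le S
    omega

end Coresets

theorem theorem1 :
    ∃ C : ℝ, 0 < C ∧
      ∀ (n d : ℕ) (A : Matrix (Fin n) (Fin d) ℝ) (ε : ℝ) (k : ℕ),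
        0 < ε → ε ≤ 1 → 1 ≤ k →
          ∃ w : Fin n → ℝ, IsCoreset A ε k w ∧ (sparsity w : ℝ) ≤ C * ((k : ℝ) / ε ^ 2) := by
  -- `385 = 6 * 8 ^ 2 + 1`, where the last unit pays for rounding up the number of steps
  refine ⟨385, by norm_num, fun n d A ε k hε hε1 hk => ?_⟩
  have hk' : (1 : ℝ) ≤ k := by exact_mod_cast hk
  have hT : 2 * (2 * (k : ℝ) + 1) ≤ (ε / 8) ^ 2 * (⌈384 * (k / ε ^ 2)⌉₊ : ℕ) := by
    refine le_trans ?_ (mul_le_mul_of_nonneg_left (Nat.le_ceil (384 * ((k : ℝ) / ε ^ 2)))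
      (by positivity))
    have : (ε / 8) ^ 2 * (384 * ((k : ℝ) / ε ^ 2)) = 6 * k := by field_simp; ring
    rw [this]; linarith
  obtain ⟨w, hw, hsp⟩ := exists_coreset_sparsity_le A hk (by positivity : 0 < ε / 8)
    (by linarith) hT
  refine ⟨w, by rwa [mul_div_cancel₀ ε (by norm_num : (8 : ℝ) ≠ 0)] at hw, ?_⟩
  have h1 : (sparsity w : ℝ) ≤ (⌈384 * ((k : ℝ) / ε ^ 2)⌉₊ : ℕ) := by exact_mod_cast hsp
  have h2 := (Nat.ceil_lt_add_one (by positivity : 0 ≤ 384 * ((k : ℝ) / ε ^ 2))).le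
  have h3 : 1 ≤ (k : ℝ) / ε ^ 2 := by
    rw [le_div_iff₀ (by positivity), one_mul]
    exact (pow_le_one₀ hε.le hε1).trans hk'
  linarith
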